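/- Let $q$ be a prime, $L>1$ an integer coprime to $q$, $\mathcal J=\{1\le j\le L-1:\gcd(j,L)=1\}$, $J=|\mathcal J|$, $m_L$ the multiplicative order of $q$ modulo $L$, and let $k<n\le m_L$. Let $\beta\in\mathbb F_{q^{m_L}}$ be a primitive $L$-th root of unity. Let $U=[u_j]_{0\le j\le L-1}$ and $U'=[u'_j]_{0\le j\le L-1}$ be matrices in $\mathbb F_{q^{m_L}}^{J\times L}$ with $\mathrm{rank}[u_j]_{j\in\mathcal J}=J$, $[u'_j]_{j\in\mathcal J}^{\mathrm T}=L^{-1}[u_j]_{j\in\mathcal J}^{-1}$, and ($u_j=0$ for all $j\notin\mathcal J$, or $u'_j=0$ for all $j\notin\mathcal J$), such that $G_L=U\,[\beta^{-ij}]_{0\le i,j<L}$ and $H_L=[\beta^{ij}]_{0\le i,j<L}\,U'^{\mathrm T}$ have all entries in $\mathbb F_q$. Let $C_L=\begin{bmatrix}\mathbf 0&I_{L-1}\\1&\mathbf 0\end{bmatrix}$ be the $L\times L$ cyclic permutation matrix and $\tau(x)=\prod_{0\le j\le L-1,\,j\notin\mathcal J}(x-\beta^j)\in\mathbb F_q[x]$.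 For exponents $0\le l_0,\dots,l_{n-1}\le L-1$ and matrices $P\in\mathbb F_q^{J\times L}$, $Q\in\mathbb F_q^{L\times J}$, the circular-shift-based code is $$\mathcal C(P,Q)=\Big\{[c_0^{\mathrm T}\ \cdots\ c_{n-1}^{\mathrm T}]:\ c_i=\sum_{s=0}^{k-1}m_sPC_L^{q^sl_i}Q,\ m_0,\dots,m_{k-1}\in\mathbb F_q^J\Big\}\subseteq\mathbb F_q^{J\times n}.$$ Put $\mathcal C_1=\mathcal C(G_L,H_L)$ and $\mathcal C_2=\mathcal C(G_L,\tau(C_L)G_L^{\mathrm T})$. For an $\mathbb F_q$-basis $\mathcal B$ (a row vector) of $\mathbb F_{q^J}$ and $\beta_0,\dots,\beta_{n-1}\in\mathbb F_{q^J}$, let $\mathcal V=\{[\sum_{s<k}u_s\beta_0^{q^s}\ \cdots\ \sum_{s<k}u_s\beta_{n-1}^{q^s}]:u\in\mathbb F_{q^J}^k\}$ and $\mathcal M_{\mathcal B}(\mathcal V)=\{M\in\mathbb F_q^{J\times n}:\mathcal BM\in\mathcal V\}$; when the $\beta_i$ are $\mathbb F_q$-linearly independent, $\mathcal M_{\mathcal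 B}(\mathcal V)$ is called a $(J\times n,q^{Jk},d)$ Gabidulin code. (1) Suppose $J\ne m_L$ and $l_j=(c'j+c)\bmod L$ for $0\le j\le n-1$, where $0\le c\le L-1$ and $1\le c'\le L-1$ are constants with $\sum_{j=0}^{k-1}c'q^j$ coprime to $L$. Then neither $\mathcal C_1$ nor $\mathcal C_2$ is a $(J\times n,q^{Jk},d)$ Gabidulin code, whatever the basis $\mathcal B$ and the $\mathbb F_q$-linearly independent points $\beta_0,\dots,\beta_{n-1}\in\mathbb F_{q^J}$. (2) Suppose $J=m_L$, and let $\mathcal V$ be the code over $\mathbb F_{q^J}$ determined as above by the points $\beta^{l_0},\dots,\beta^{l_{n-1}}$. If $\mathrm{rank}\big(\sum_{i=0}^{n-1}a_iG_LC_L^{l_i}H_L\big)=J$ for all nonzero $[a_0,\dots,a_{n-1}]\in\mathbb F_q^n$ (the condition imposed on the exponents to make $\mathcal C_1$ and $\mathcal C_2$ maximum rank distance codes), then these points are $\mathbb F_q$-linearly independent, so that $\mathcal V$ is a Gabidulin linear code. Moreover $\mathcal B=u_1^{\mathrm T}$ is a basis of $\mathbb F_{q^J}$ over $\mathbb F_q$;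 the matrix $T=L\,[u_{L-j}]_{j\in\mathcal J}\,\mathrm{Diag}([\tau(\beta^j)]_{j\in\mathcal J})\,[u_j]_{j\in\mathcal J}^{\mathrm T}$ is an invertible matrix over $\mathbb F_q$; $\mathcal BT^{-1}$ is a basis; and $$\mathcal C_1=\mathcal M_{\mathcal B}(\mathcal V),\qquad \mathcal C_2=T\mathcal M_{\mathcal B}(\mathcal V)=\mathcal M_{\mathcal BT^{-1}}(\mathcal V).$$ -/

import Mathlib

open Polynomial Matrix
open scoped Kronecker

noncomputable section

namespace CircShift

/-- The set of all `j` with `1 ≤ j ≤ L - 1` and `gcd(j, L) = 1`. -/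
def coprimeIdx (L : ℕ) : Finset (Fin L) :=
  Finset.univ.filter fun j => 1 ≤ (j : ℕ) ∧ Nat.Coprime j L

/-- The number `J` of positive integers less than `L` that are coprime to `L`. -/
def J (L : ℕ) : ℕ := (coprimeIdx L).card

/-- The increasing enumeration `d_1 < ... < d_J` of the integers below `L` coprime to `L`. -/
def enum (L : ℕ) : Fin (J L) → Fin L := (coprimeIdx L).orderEmbOfFin rfl

/-- The index `L - j` (read modulo `L`). -/
def negIdx {L : ℕ} (j : Fin L) : Fin L := ⟨(L - j) % L, Nat.mod_lt _ j.pos⟩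

/-- The multiplicative order `m_L` of `q` modulo `L`. -/
def mOrd (q L : ℕ) : ℕ := orderOf (q : ZMod L)

/-- The `L × L` cyclic permutation matrix, with rows `e_1, ..., e_{L-1}, e_0`. -/
def cyc (R : Type*) [CommRing R] (L : ℕ) : Matrix (Fin L) (Fin L) R :=
  Matrix.of fun i j => if (j : ℕ) = (i + 1) % L then 1 else 0

section Matrices

variable {K : Type*} [Field K] {L : ℕ}

/-- The matrix with entries `β ^ (i j)`, `0 ≤ i, j < L`. -/
def vand (β : K) (L : ℕ) : Matrix (Fin L) (Fin L) K :=
  Matrix.of fun i j => β ^ ((i : ℕ) * (j : ℕ))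

/-- The matrix with entries `β ^ (-i j)`, `0 ≤ i, j < L`. -/
def vandInv (β : K) (L : ℕ) : Matrix (Fin L) (Fin L) K :=
  Matrix.of fun i j => (β⁻¹) ^ ((i : ℕ) * (j : ℕ))

/-- The square matrix formed by the columns `u_j`, `j` coprime to `L`, in increasing order. -/
def coprimeCols (U : Matrix (Fin (J L)) (Fin L) K) : Matrix (Fin (J L)) (Fin (J L)) K :=
  U.submatrix id (enum L)

/-- The square matrix formed by the columns `u_{L-j}`, `j` coprime to `L`, `j` increasing. -/
def negCoprimeCols (U : Matrix (Fin (J L)) (Fin L) K) : Matrix (Fin (J L)) (Fin (J L)) K :=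
  U.submatrix id fun i => negIdx (enum L i)

/-- The three conditions on the pair `U`, `U'`. -/
structure Admissible (U U' : Matrix (Fin (J L)) (Fin L) K) : Prop where
  rank_eq : (coprimeCols U).rank = J L
  inverse : (coprimeCols U')ᵀ = (L : K)⁻¹ • (coprimeCols U)⁻¹
  zero_outside : (∀ j, j ∉ coprimeIdx L → ∀ r, U r j = 0) ∨
    (∀ j, j ∉ coprimeIdx L → ∀ r, U' r j = 0)

/-- `τ(x)`, the product of `x - β ^ j` over all `0 ≤ j < L` that do not lie in
`coprimeIdx L`, over the field that contains `β`. -/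
def tauExt (β : K) (L : ℕ) : K[X] :=
  ∏ j ∈ Finset.univ.filter (fun j : Fin L => j ∉ coprimeIdx L), (X - C (β ^ (j : ℕ)))

/-- The matrix `T = L [u_{L-j}] Diag(τ(β ^ j)) [u_j]ᵀ`, over the field that contains `β`. -/
def TExt (β : K) (U : Matrix (Fin (J L)) (Fin L) K) : Matrix (Fin (J L)) (Fin (J L)) K :=
  (L : K) • (negCoprimeCols U *
    Matrix.diagonal (fun i => (tauExt β L).eval (β ^ (enum L i : ℕ))) * (coprimeCols U)ᵀ)

/-- `τ` has coefficients in every subfield. -/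
theorem exists_tau (F : Type*) [Field F] [Algebra F K] {β : K} (hL : 1 < L)
    (hβ : IsPrimitiveRoot β L) : ∃ p : F[X], p.map (algebraMap F K) = tauExt β L := by
  have hpos : 0 < L := by omega
  have : NeZero L := ⟨by omega⟩
  refine ⟨∏ d ∈ L.properDivisors, cyclotomic d F, ?_⟩
  have h1 : (∏ d ∈ L.properDivisors, cyclotomic d K) * cyclotomic L K = X ^ L - 1 := by
    rw [← prod_cyclotomic_eq_X_pow_sub_one hpos, ← Nat.cons_self_properDivisors (by omega),
      Finset.prod_cons, mul_comm]
  have h2 : cyclotomic L K = ∏ j ∈ coprimeIdx L, (X - C (β ^ (j : ℕ))) := by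
    rw [cyclotomic_eq_prod_X_sub_primitiveRoots hβ]
    symm
    refine Finset.prod_bij (fun (j : Fin L) _ => β ^ (j : ℕ)) ?_ ?_ ?_ ?_
    · intro j hj
      simp only [coprimeIdx, Finset.mem_filter] at hj
      exact (mem_primitiveRoots hpos).2 (hβ.pow_of_coprime _ hj.2.2)
    · intro i _ j _ h
      exact Fin.ext (hβ.pow_inj i.2 j.2 h)
    · intro b hb
      obtain ⟨i, hi, hc, rfl⟩ := (hβ.isPrimitiveRoot_iff).1 ((mem_primitiveRoots hpos).1 hb)
      refine ⟨⟨i, hi⟩, ?_, rfl⟩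
      simp only [coprimeIdx, Finset.mem_filter, Finset.mem_univ, true_and]
      refine ⟨?_, hc⟩
      rcases Nat.eq_zero_or_pos i with h | h
      · subst h
        simp at hc
        omega
      · exact h
    · intro j _
      rfl
  have h3 : tauExt β L * ∏ j ∈ coprimeIdx L, (X - C (β ^ (j : ℕ))) = X ^ L - 1 := by
    have hs : (Finset.univ.filter fun j : Fin L => j ∈ coprimeIdx L) = coprimeIdx L := by
      ext; simp
    have := Finset.prod_filter_mul_prod_filter_not Finset.univ (fun j : Fin L => j ∈ coprimeIdx L)
      (fun j => (X - C (β ^ (j : ℕ)) : K[X]))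
    rw [hs] at this
    rw [tauExt, mul_comm, this, X_pow_sub_one_eq_prod hpos hβ]
    refine Finset.prod_bij (fun (j : Fin L) _ => β ^ (j : ℕ)) ?_ ?_ ?_ ?_
    · intro j _
      rw [mem_nthRootsFinset hpos, ← pow_mul, mul_comm, pow_mul, hβ.pow_eq_one, one_pow]
    · intro i _ j _ h
      exact Fin.ext (hβ.pow_inj i.2 j.2 h)
    · intro b hb
      obtain ⟨i, hi, rfl⟩ := hβ.eq_pow_of_pow_eq_one ((mem_nthRootsFinset hpos 1).1 hb)
      exact ⟨⟨i, hi⟩, Finset.mem_univ _, rfl⟩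
    · intro j _
      rfl
  have h4 : cyclotomic L K ≠ 0 := cyclotomic_ne_zero L K
  apply mul_right_cancel₀ h4
  rw [Polynomial.map_prod]
  simp only [map_cyclotomic]
  rw [h1, h2, h3]

/-- `τ(x)` as a polynomial over `F`. -/
def tau (F : Type*) [Field F] [Algebra F K] {β : K} (hL : 1 < L)
    (hβ : IsPrimitiveRoot β L) : F[X] := (exists_tau F hL hβ).choose

theorem map_tau (F : Type*) [Field F] [Algebra F K] {β : K} (hL : 1 < L)
    (hβ : IsPrimitiveRoot β L) : (tau F hL hβ).map (algebraMap F K) = tauExt β L :=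
  (exists_tau F hL hβ).choose_spec

end Matrices

section Codes

variable (q : ℕ) [Fact q.Prime]

/-- The `k × n` block matrix whose block at `(s, i)` is `C_L ^ (q ^ s l_i)`. -/
def Psi (k : ℕ) {n L : ℕ} (l : Fin n → Fin L) :
    Matrix (Fin k × Fin L) (Fin n × Fin L) (ZMod q) :=
  Matrix.of fun x y => (cyc (ZMod q) L ^ (q ^ (x.1 : ℕ) * (l y.1 : ℕ))) x.2 y.2

/-- `Δ(c) = [c_0ᵀ c_1ᵀ ... c_{n-1}ᵀ]`. -/
def Delta {F : Type*} {N n : ℕ} (c : Fin n × Fin N → F) : Matrix (Fin N) (Fin n) F :=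
  Matrix.of fun r i => c (i, r)

/-- The circular-shift-based rank-metric code
`{Δ(m (I_k ⊗ P) Ψ (I_n ⊗ Q)) : m a row vector of length J k over 𝔽_q}`. -/
def circCode (k : ℕ) {n L : ℕ} (l : Fin n → Fin L)
    (P : Matrix (Fin (J L)) (Fin L) (ZMod q)) (Q : Matrix (Fin L) (Fin (J L)) (ZMod q)) :
    Set (Matrix (Fin (J L)) (Fin n) (ZMod q)) :=
  Set.range fun m : Fin k × Fin (J L) → ZMod q =>
    Delta (m ᵥ* (((1 : Matrix (Fin k) (Fin k) (ZMod q)) ⊗ₖ P) * Psi q k l *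
      ((1 : Matrix (Fin n) (Fin n) (ZMod q)) ⊗ₖ Q)))

variable {E : Type*} [Field E] [Algebra (ZMod q) E]

/-- The generator matrix with entries `β_i ^ (q ^ s)`, `0 ≤ s < k`, `0 ≤ i < n`. -/
def gabGen (k : ℕ) {n : ℕ} (pts : Fin n → E) : Matrix (Fin k) (Fin n) E :=
  Matrix.of fun s i => pts i ^ q ^ (s : ℕ)

/-- The linear code `{u 𝐆 : u ∈ E ^ k}`. -/
def gabLinear (k : ℕ) {n : ℕ} (pts : Fin n → E) : Set (Fin n → E) :=
  Set.range fun u : Fin k → E => u ᵥ* gabGen q k pts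

variable {q}

/-- The matrix over `𝔽_q` whose `i`-th column holds the coordinates of `v_i` in the basis. -/
def coordMatrix {N n : ℕ} (b : Module.Basis (Fin N) (ZMod q) E) (v : Fin n → E) :
    Matrix (Fin N) (Fin n) (ZMod q) :=
  Matrix.of fun r i => b.repr (v i) r

/-- `{M_b(v) : v ∈ V}`. -/
def coordCode {N n : ℕ} (b : Module.Basis (Fin N) (ZMod q) E) (V : Set (Fin n → E)) :
    Set (Matrix (Fin N) (Fin n) (ZMod q)) :=
  coordMatrix b '' V

variable (E) in
/-- The set `M` is a Gabidulin rank-metric code over `E` of dimension parameter `k`, for some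
basis of `E` over `𝔽_q` and some linearly independent evaluation points. -/
def IsGabidulin (k : ℕ) {N n : ℕ} (M : Set (Matrix (Fin N) (Fin n) (ZMod q))) : Prop :=
  ∃ (b : Module.Basis (Fin N) (ZMod q) E) (pts : Fin n → E),
    LinearIndependent (ZMod q) pts ∧ M = coordCode b (gabLinear q k pts)

end Codes

end CircShift

end

namespace CircShift

/-! The columns of `vand β L` are eigenvectors of the cyclic matrix $C$, so with
$A=[u_j]_{j\in\mathcal J}$ one gets $G\,p(C)\,H=A\,\mathrm{Diag}(p(\beta^j))\,A^{-1}$ for every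
polynomial $p$ over $\mathbb F_q$ (`map_mul_aeval_mul_of_admissible`). Pairing a codeword column
with $u_j$ therefore gives a $q$-polynomial evaluation: $c_i^{\mathrm T}u_j=\sum_s(m_s^{\mathrm
T}u_j)\,\beta^{jq^sl_i}$ (`sum_codeword_mul`). Likewise $G\,p(C)\,\tau(C)G^{\mathrm
T}=G\,p(C)\,H\,T^{\mathrm T}$, so $\mathcal C_2=T\mathcal C_1$, and left multiplication by an
invertible matrix only changes the basis.

If $J=m_L$, then $q$ generates $(\mathbb Z/L)^\times$, all $\beta^j$ with $j\in\mathcal J$ are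
conjugate, and $u_1$ is a basis (`linearIndependent_col_one`). The pairing with $j=1$ is then the
Gabidulin encoding.

If $J\ne m_L$, then $m_L<J$. Consider codewords whose columns $1,\dots,k-1$ vanish. Column 0 is
arbitrary and determines column $k$ through $c_k^{\mathrm T}u_j=\lambda_j\,c_0^{\mathrm T}u_j$, with
$J$ distinct $\lambda_j\in K$ (`sum_codeword_mul_eq_of_eq_zero`). If the code were linear over
$E=\mathbb F_{q^J}$, the map $c_0\mapsto c_k$ would be multiplication by some $y\in E$. All
$\lambda_j$ would be roots of the minimal polynomial of $y$, forcing its degree to be at least $J$;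
but an irreducible polynomial with a root in $K$ has degree at most $m_L$
(`not_linear_over_extension`). -/

theorem isUnit_of_rank_eq_card {N : ℕ} {K : Type*} [Field K] {A : Matrix (Fin N) (Fin N) K}
    (h : A.rank = N) : IsUnit A := by
  rw [← linearIndependent_cols_iff_isUnit, linearIndependent_iff_card_eq_finrank_span,
    Fintype.card_fin, Set.finrank, ← rank_eq_finrank_span_cols, h]

/-! ### Residues coprime to `L` and the order of `q` -/

section Index

variable {L : ℕ}

theorem mem_coprimeIdx {j : Fin L} : j ∈ coprimeIdx L ↔ 1 ≤ (j : ℕ) ∧ Nat.Coprime j L := by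
  simp [coprimeIdx]

theorem enum_mem (i : Fin (J L)) : enum L i ∈ coprimeIdx L :=
  Finset.orderEmbOfFin_mem _ _ _

theorem enum_coprime (i : Fin (J L)) : Nat.Coprime (enum L i) L :=
  (mem_coprimeIdx.1 (enum_mem i)).2

theorem enum_injective : Function.Injective (enum L) :=
  ((coprimeIdx L).orderEmbOfFin rfl).injective

theorem exists_enum_eq {j : Fin L} (hj : j ∈ coprimeIdx L) : ∃ i, enum L i = j := by
  have : j ∈ Set.range ((coprimeIdx L).orderEmbOfFin rfl) := by
    rw [Finset.range_orderEmbOfFin]; exact hj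
  exact this

theorem exists_enum_eq_one (hL : 1 < L) : ∃ i, enum L i = ⟨1, hL⟩ :=
  exists_enum_eq (mem_coprimeIdx.2 ⟨le_rfl, Nat.coprime_one_left L⟩)

theorem sum_eq_sum_enum {M : Type*} [AddCommMonoid M] (f : Fin L → M)
    (hf : ∀ j, j ∉ coprimeIdx L → f j = 0) : ∑ j, f j = ∑ i, f (enum L i) := by
  rw [← Finset.sum_subset (Finset.subset_univ (coprimeIdx L)) fun j _ hj => hf j hj]
  symm
  refine Finset.sum_bij (fun i _ => enum L i) (fun i _ => enum_mem i)
    (fun _ _ _ _ h => enum_injective h) (fun j hj => ?_) fun _ _ => rfl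
  obtain ⟨i, hi⟩ := exists_enum_eq hj
  exact ⟨i, Finset.mem_univ _, hi⟩

theorem negIdx_add (j : Fin L) : ((negIdx j : ℕ) + j) % L = 0 := by
  have := j.2
  simp only [negIdx, Nat.mod_add_mod]
  rw [Nat.sub_add_cancel this.le, Nat.mod_self]

theorem negIdx_negIdx (j : Fin L) : negIdx (negIdx j) = j := by
  have := j.2
  ext
  simp only [negIdx]
  rcases Nat.eq_zero_or_pos (j : ℕ) with h | h
  · simp [h]
  · rw [Nat.mod_eq_of_lt (show L - (j : ℕ) < L by omega), Nat.sub_sub_self this.le,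
      Nat.mod_eq_of_lt this]

theorem negIdx_mem {j : Fin L} (hj : j ∈ coprimeIdx L) : negIdx j ∈ coprimeIdx L := by
  obtain ⟨h1, h2⟩ := mem_coprimeIdx.1 hj
  have := j.2
  have h3 : (negIdx j : ℕ) = L - j := Nat.mod_eq_of_lt (by omega)
  refine mem_coprimeIdx.2 ⟨by omega, ?_⟩
  rw [h3, Nat.coprime_comm]
  exact (Nat.coprime_self_sub_right this.le).2 h2.symm

theorem J_eq_totient (hL : 1 < L) : J L = L.totient := by
  rw [Nat.totient_eq_card_coprime, J]
  refine Finset.card_bij (fun j _ => (j : ℕ)) (fun j hj => ?_) (fun _ _ _ _ h => Fin.ext h)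
    fun b hb => ?_
  · simpa using (mem_coprimeIdx.1 hj).2.symm
  · simp only [Finset.mem_filter, Finset.mem_range] at hb
    refine ⟨⟨b, hb.1⟩, mem_coprimeIdx.2 ⟨?_, hb.2.symm⟩, rfl⟩
    rcases Nat.eq_zero_or_pos b with rfl | h
    · have := hb.2
      simp at this
      omega
    · exact h

theorem J_pos (hL : 1 < L) : 0 < J L := by
  rw [J_eq_totient hL]
  exact Nat.totient_pos.2 (by omega)

theorem mOrd_eq_orderOf_unit {q : ℕ} (h : Nat.Coprime q L) :
    mOrd q L = orderOf (ZMod.unitOfCoprime q h) := by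
  rw [mOrd, ← orderOf_units, ZMod.coe_unitOfCoprime]

theorem mOrd_pos {q : ℕ} (hL : 1 < L) (h : Nat.Coprime q L) : 0 < mOrd q L := by
  have : NeZero L := ⟨by omega⟩
  rw [mOrd_eq_orderOf_unit h]
  exact orderOf_pos _

theorem mOrd_le_J {q : ℕ} (hL : 1 < L) (h : Nat.Coprime q L) : mOrd q L ≤ J L := by
  have : NeZero L := ⟨by omega⟩
  rw [mOrd_eq_orderOf_unit h, J_eq_totient hL, ← ZMod.card_units_eq_totient]
  exact orderOf_le_card_univ

/-- When the order of `q` equals the totient of `L`, the powers of `q` exhaust the unit group. -/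
theorem exists_pow_modEq {q : ℕ} (hL : 1 < L) (h : Nat.Coprime q L) (hJ : J L = mOrd q L)
    {j : ℕ} (hj : Nat.Coprime j L) : ∃ t : ℕ, q ^ t ≡ j [MOD L] := by
  have : NeZero L := ⟨by omega⟩
  have htop : Subgroup.zpowers (ZMod.unitOfCoprime q h) = ⊤ := by
    apply Subgroup.eq_top_of_card_eq
    rw [Nat.card_zpowers, ← mOrd_eq_orderOf_unit h, ← hJ, J_eq_totient hL, Nat.card_eq_fintype_card,
      ZMod.card_units_eq_totient]
  have hmem : ZMod.unitOfCoprime j hj ∈ Subgroup.zpowers (ZMod.unitOfCoprime q h) := by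
    rw [htop]; trivial
  obtain ⟨t, ht⟩ := (mem_powers_iff_mem_zpowers).2 hmem
  refine ⟨t, ?_⟩
  rw [← ZMod.natCast_eq_natCast_iff]
  have := congrArg (Units.val) ht
  simpa using this

end Index

/-! ### Simultaneous diagonalization of circulant matrices -/

section Diagonalization

variable {K : Type*} [Field K] {L : ℕ} {β : K}

theorem pow_eq_pow_of_modEq (hβ : IsPrimitiveRoot β L) {a b : ℕ} (h : a ≡ b [MOD L]) :
    β ^ a = β ^ b := by
  rw [← pow_mod_orderOf β a, ← pow_mod_orderOf β b, ← hβ.eq_orderOf, h]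

theorem vandInv_mul_vand (hL : 1 < L) (hβ : IsPrimitiveRoot β L) :
    vandInv β L * vand β L = (L : K) • 1 := by
  have hβ0 : β ≠ 0 := hβ.ne_zero (by omega)
  ext i j
  have hsum : (vandInv β L * vand β L) i j =
      ∑ t ∈ Finset.range L, ((β⁻¹) ^ (i : ℕ) * β ^ (j : ℕ)) ^ t := by
    rw [mul_apply, ← Fin.sum_univ_eq_sum_range (fun t => ((β⁻¹) ^ (i : ℕ) * β ^ (j : ℕ)) ^ t)]
    refine Finset.sum_congr rfl fun t _ => ?_
    simp only [vandInv, vand, of_apply]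
    rw [mul_pow, ← pow_mul, ← pow_mul, mul_comm (t : ℕ)]
  rw [hsum, Matrix.smul_apply, smul_eq_mul]
  by_cases hij : i = j
  · subst hij
    rw [← mul_pow, inv_mul_cancel₀ hβ0]
    simp
  · rw [one_apply_ne hij, mul_zero]
    have h1 : (β⁻¹) ^ (i : ℕ) * β ^ (j : ℕ) - 1 ≠ 0 := by
      intro h
      apply hij
      apply Fin.ext
      apply hβ.pow_inj i.2 j.2
      rw [sub_eq_zero, inv_pow] at h
      exact ((inv_mul_eq_one₀ (pow_ne_zero _ hβ0)).1 h)
    apply (mul_eq_zero.1 _).resolve_left h1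
    rw [mul_geom_sum, mul_pow, ← pow_mul, ← pow_mul, mul_comm (i : ℕ), mul_comm (j : ℕ), pow_mul,
      pow_mul, inv_pow, hβ.pow_eq_one]
    simp

theorem vandInv_apply (hβ : IsPrimitiveRoot β L) (i j : Fin L) :
    vandInv β L i j = vand β L i (negIdx j) := by
  have hL : L ≠ 0 := by have := i.2; omega
  have hβ0 : β ≠ 0 := hβ.ne_zero hL
  simp only [vandInv, vand, of_apply]
  rw [inv_pow]
  apply inv_eq_of_mul_eq_one_right
  rw [← pow_add, ← mul_add, add_comm]
  apply (hβ.pow_eq_one_iff_dvd _).2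
  exact Dvd.dvd.mul_left (Nat.dvd_of_mod_eq_zero (negIdx_add j)) _

theorem vandInv_transpose : (vandInv β L)ᵀ = vandInv β L := by
  ext i j
  simp [vandInv, mul_comm]

theorem cyc_mul_vand (hβ : IsPrimitiveRoot β L) :
    cyc K L * vand β L = vand β L * diagonal fun j : Fin L => β ^ (j : ℕ) := by
  ext i j
  have hL : 0 < L := i.pos
  rw [mul_diagonal, mul_apply, Finset.sum_eq_single ⟨(i + 1) % L, Nat.mod_lt _ hL⟩]
  · simp only [cyc, vand, of_apply, if_true, one_mul]
    rw [← pow_add]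
    apply pow_eq_pow_of_modEq hβ
    have := (Nat.mod_modEq ((i : ℕ) + 1) L).mul_right (j : ℕ)
    rwa [add_mul, one_mul] at this
  · intro b _ hb
    simp only [cyc, of_apply]
    rw [if_neg, zero_mul]
    exact fun h => hb (Fin.ext h)
  · simp

theorem aeval_cyc_mul_vand (hβ : IsPrimitiveRoot β L) (p : K[X]) :
    aeval (cyc K L) p * vand β L =
      vand β L * diagonal fun j : Fin L => p.eval (β ^ (j : ℕ)) := by
  induction p using Polynomial.induction_on' with
  | add p r hp hr =>
    simp only [map_add, add_mul, hp, hr, eval_add, ← mul_add, diagonal_add]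
  | monomial m a =>
    have hpow : cyc K L ^ m * vand β L =
        vand β L * diagonal fun j : Fin L => (β ^ (j : ℕ)) ^ m := by
      induction m with
      | zero => simp
      | succ m ih =>
        rw [pow_succ, Matrix.mul_assoc, cyc_mul_vand hβ, ← Matrix.mul_assoc, ih, Matrix.mul_assoc,
          diagonal_mul_diagonal]
        simp only [pow_succ]
    simp only [aeval_monomial, eval_monomial]
    rw [← Algebra.smul_def, Matrix.smul_mul, hpow, ← Matrix.mul_smul, ← diagonal_smul]
    rfl

theorem map_cyc (F : Type*) [Field F] [Algebra F K] :
    (cyc F L).map (algebraMap F K) = cyc K L := by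
  ext i j
  simp only [cyc, map_apply, of_apply]
  split_ifs <;> simp

theorem map_aeval_cyc (F : Type*) [Field F] [Algebra F K] (p : F[X]) :
    (aeval (cyc F L) p).map (algebraMap F K) = aeval (cyc K L) (p.map (algebraMap F K)) := by
  have h := Polynomial.map_aeval_eq_aeval_map (R := F) (S := Matrix (Fin L) (Fin L) F)
    (T := K) (U := Matrix (Fin L) (Fin L) K) (φ := algebraMap F K)
    (ψ := (algebraMap F K).mapMatrix) ?_ p (cyc F L)
  · rw [← map_cyc (K := K) F]
    simpa using h
  · ext r i j
    simp [Matrix.algebraMap_matrix_apply]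
    split_ifs <;> simp

/-- Circulant matrices between `G` and a matrix of the shape `[β ^ (i j)] Wᵀ` act diagonally. -/
theorem map_mul_aeval_cyc_mul {F : Type*} [Field F] [Algebra F K] (hL : 1 < L)
    (hβ : IsPrimitiveRoot β L) {N : ℕ} {U W : Matrix (Fin N) (Fin L) K}
    {G : Matrix (Fin N) (Fin L) F} {H : Matrix (Fin L) (Fin N) F}
    (hG : G.map (algebraMap F K) = U * vandInv β L)
    (hH : H.map (algebraMap F K) = vand β L * Wᵀ) (p : F[X]) :
    (G * aeval (cyc F L) p * H).map (algebraMap F K) =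
      (L : K) • (U * (diagonal fun j : Fin L => aeval (β ^ (j : ℕ)) p) * Wᵀ) := by
  rw [Matrix.map_mul, Matrix.map_mul, hG, hH, map_aeval_cyc]
  calc U * vandInv β L * aeval (cyc K L) (p.map (algebraMap F K)) * (vand β L * Wᵀ)
      = U * (vandInv β L * (aeval (cyc K L) (p.map (algebraMap F K)) * vand β L)) * Wᵀ := by
        simp only [Matrix.mul_assoc]
    _ = _ := by
        rw [aeval_cyc_mul_vand hβ, ← Matrix.mul_assoc (vandInv β L), vandInv_mul_vand hL hβ]
        simp [Matrix.mul_assoc, eval_map_algebraMap]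

/-- Only the triple product must vanish outside `coprimeIdx L`, so the zero may come from `U`, from
`W`, or from the values of `τ` on the diagonal. -/
theorem mul_diagonal_mul_eq_of_zero_outside {N : ℕ} {U W : Matrix (Fin N) (Fin L) K}
    {d : Fin L → K} (h : ∀ j, j ∉ coprimeIdx L → ∀ r r', U r j * d j * W r' j = 0) :
    U * diagonal d * Wᵀ = U.submatrix id (enum L) * diagonal (fun i => d (enum L i)) *
      (W.submatrix id (enum L))ᵀ := by
  ext r r'
  rw [mul_apply, mul_apply]
  simp only [mul_diagonal, transpose_apply, submatrix_apply, id]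
  exact sum_eq_sum_enum _ fun j hj => h j hj r r'

end Diagonalization

/-! ### Blockwise description of the codewords -/

section Codewords

variable {q : ℕ} [Fact q.Prime] {L k n : ℕ}

/-- The codeword of the message `m` in a circular-shift-based code. -/
def codeword (l : Fin n → Fin L) (P : Matrix (Fin (J L)) (Fin L) (ZMod q))
    (Q : Matrix (Fin L) (Fin (J L)) (ZMod q)) (m : Fin k × Fin (J L) → ZMod q) :
    Matrix (Fin (J L)) (Fin n) (ZMod q) :=
  Matrix.of fun r i => ∑ s : Fin k,
    ((fun r' => m (s, r')) ᵥ* (P * cyc (ZMod q) L ^ (q ^ (s : ℕ) * (l i : ℕ)) * Q)) r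

theorem circCode_eq_range (l : Fin n → Fin L) (P : Matrix (Fin (J L)) (Fin L) (ZMod q))
    (Q : Matrix (Fin L) (Fin (J L)) (ZMod q)) :
    circCode q k l P Q = Set.range (codeword (k := k) l P Q) := by
  unfold circCode
  congr 1
  ext m r i
  have key : ∀ (s : Fin k) (r' : Fin (J L)),
      (((1 : Matrix (Fin k) (Fin k) (ZMod q)) ⊗ₖ P) * Psi q k l *
        ((1 : Matrix (Fin n) (Fin n) (ZMod q)) ⊗ₖ Q)) (s, r') (i, r) =
      (P * cyc (ZMod q) L ^ (q ^ (s : ℕ) * (l i : ℕ)) * Q) r' r := by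
    intro s r'
    have h1 : ∀ (i' : Fin n) (b : Fin L),
        (((1 : Matrix (Fin k) (Fin k) (ZMod q)) ⊗ₖ P) * Psi q k l) (s, r') (i', b) =
        (P * cyc (ZMod q) L ^ (q ^ (s : ℕ) * (l i' : ℕ))) r' b := by
      intro i' b
      rw [mul_apply, Fintype.sum_prod_type, Finset.sum_eq_single s, mul_apply]
      · refine Finset.sum_congr rfl fun a _ => ?_
        simp [kroneckerMap_apply, Psi]
      · intro s' _ hs'
        refine Finset.sum_eq_zero fun a _ => ?_
        simp [kroneckerMap_apply, one_apply_ne hs'.symm]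
      · simp
    rw [mul_apply, Fintype.sum_prod_type, Finset.sum_eq_single i, mul_apply]
    · refine Finset.sum_congr rfl fun b _ => ?_
      rw [h1]
      simp [kroneckerMap_apply]
    · intro i' _ hi'
      refine Finset.sum_eq_zero fun a _ => ?_
      simp [kroneckerMap_apply, one_apply_ne hi']
    · simp
  simp only [Delta, codeword, of_apply, vecMul, dotProduct]
  rw [Fintype.sum_prod_type]
  simp only [key]

theorem codeword_add (l : Fin n → Fin L) (P : Matrix (Fin (J L)) (Fin L) (ZMod q))
    (Q : Matrix (Fin L) (Fin (J L)) (ZMod q)) (m m' : Fin k × Fin (J L) → ZMod q) :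
    codeword l P Q (m + m') = codeword l P Q m + codeword l P Q m' := by
  ext r i
  simp only [codeword, of_apply, Matrix.add_apply, ← Finset.sum_add_distrib]
  refine Finset.sum_congr rfl fun s _ => ?_
  rw [← Pi.add_apply, ← add_vecMul]
  rfl

theorem codeword_smul (l : Fin n → Fin L) (P : Matrix (Fin (J L)) (Fin L) (ZMod q))
    (Q : Matrix (Fin L) (Fin (J L)) (ZMod q)) (a : ZMod q) (m : Fin k × Fin (J L) → ZMod q) :
    codeword l P Q (a • m) = a • codeword l P Q m := by
  ext r i
  simp only [codeword, of_apply, Matrix.smul_apply, Finset.smul_sum]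
  refine Finset.sum_congr rfl fun s _ => ?_
  rw [← Pi.smul_apply, ← smul_vecMul]
  rfl

/-- Messages act as row vectors while codeword blocks are stored as columns; hence the transpose on
`T`. -/
theorem codeword_mul_transpose (l : Fin n → Fin L) (P : Matrix (Fin (J L)) (Fin L) (ZMod q))
    {Q Q' : Matrix (Fin L) (Fin (J L)) (ZMod q)} {T : Matrix (Fin (J L)) (Fin (J L)) (ZMod q)}
    (h : ∀ a : ℕ, P * cyc (ZMod q) L ^ a * Q' = P * cyc (ZMod q) L ^ a * Q * Tᵀ)
    (m : Fin k × Fin (J L) → ZMod q) :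
    codeword l P Q' m = T * codeword l P Q m := by
  ext r i
  rw [Matrix.mul_apply]
  simp only [codeword, of_apply, h, Finset.mul_sum]
  rw [Finset.sum_comm]
  refine Finset.sum_congr rfl fun s _ => ?_
  rw [← vecMul_vecMul]
  simp only [vecMul, dotProduct, transpose_apply]
  exact Finset.sum_congr rfl fun _ _ => mul_comm _ _

end Codewords

/-! ### The code matrices in the eigenbasis, and the matrix `T` -/

section Admissible

variable {q : ℕ} [Fact q.Prime] {L : ℕ} {K : Type*} [Field K] [Algebra (ZMod q) K] {β : K}
  {U U' : Matrix (Fin (J L)) (Fin L) K} {G : Matrix (Fin (J L)) (Fin L) (ZMod q)}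
  {H : Matrix (Fin L) (Fin (J L)) (ZMod q)}

theorem Admissible.isUnit (hU : Admissible U U') : IsUnit (coprimeCols U) :=
  isUnit_of_rank_eq_card hU.rank_eq

theorem natCast_ne_zero (hL : 1 < L) (hβ : IsPrimitiveRoot β L) : (L : K) ≠ 0 := by
  have : NeZero L := ⟨by omega⟩
  exact (hβ.neZero').out

/-- The factor `L` from the product of the two Fourier matrices cancels the $L^{-1}$ in the
definition of `U'`, which leaves a genuine conjugation. -/
theorem map_mul_aeval_mul_of_admissible (hL : 1 < L) (hβ : IsPrimitiveRoot β L)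
    (hU : Admissible U U') (hG : G.map (algebraMap (ZMod q) K) = U * vandInv β L)
    (hH : H.map (algebraMap (ZMod q) K) = vand β L * U'ᵀ) (p : (ZMod q)[X]) :
    (G * aeval (cyc (ZMod q) L) p * H).map (algebraMap (ZMod q) K) =
      coprimeCols U * diagonal (fun i => aeval (β ^ (enum L i : ℕ)) p) *
        (coprimeCols U)⁻¹ := by
  rw [map_mul_aeval_cyc_mul hL hβ hG hH, mul_diagonal_mul_eq_of_zero_outside]
  · change (L : K) • (coprimeCols U * _ * (coprimeCols U')ᵀ) = _
    rw [hU.inverse, Matrix.mul_smul, smul_smul, mul_inv_cancel₀ (natCast_ne_zero hL hβ), one_smul]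
  · intro j hj r r'
    rcases hU.zero_outside with h | h
    · rw [h j hj, zero_mul, zero_mul]
    · rw [h j hj, mul_zero]

/-- Reindexing by $j\mapsto -j$ turns $\beta^{-ij}$ into $\beta^{ij}$, so $G^{\mathrm T}$ has the
shape of $H$, with the columns $u_{L-j}$ in the role of $u'_j$. -/
theorem map_transpose_eq (hβ : IsPrimitiveRoot β L)
    (hG : G.map (algebraMap (ZMod q) K) = U * vandInv β L) :
    Gᵀ.map (algebraMap (ZMod q) K) = vand β L * (U.submatrix id negIdx)ᵀ := by
  rw [transpose_map, hG, transpose_mul, vandInv_transpose]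
  ext i r
  rw [mul_apply, mul_apply]
  refine Finset.sum_bij (fun j _ => negIdx j) (fun _ _ => Finset.mem_univ _)
    (fun a _ b _ h => by rw [← negIdx_negIdx a, h, negIdx_negIdx])
    (fun b _ => ⟨negIdx b, Finset.mem_univ _, negIdx_negIdx b⟩) fun j _ => ?_
  simp [vandInv_apply hβ, negIdx_negIdx]

theorem eval_tauExt_eq_zero {j : Fin L} (hj : j ∉ coprimeIdx L) :
    (tauExt β L).eval (β ^ (j : ℕ)) = 0 := by
  rw [tauExt, eval_prod]
  exact Finset.prod_eq_zero (i := j) (by simpa using hj) (by simp)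

theorem eval_tauExt_ne_zero (hβ : IsPrimitiveRoot β L) {j : Fin L} (hj : j ∈ coprimeIdx L) :
    (tauExt β L).eval (β ^ (j : ℕ)) ≠ 0 := by
  rw [tauExt, eval_prod, Finset.prod_ne_zero_iff]
  intro i hi h
  simp only [eval_sub, eval_X, eval_C, sub_eq_zero] at h
  have : j = i := Fin.ext (hβ.pow_inj j.2 i.2 h)
  subst this
  exact (Finset.mem_filter.1 hi).2 hj

theorem map_mul_aeval_mul_tau (hL : 1 < L) (hβ : IsPrimitiveRoot β L)
    (hG : G.map (algebraMap (ZMod q) K) = U * vandInv β L) (p : (ZMod q)[X]) :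
    (G * aeval (cyc (ZMod q) L) (p * tau (ZMod q) hL hβ) * Gᵀ).map (algebraMap (ZMod q) K) =
      (L : K) • (coprimeCols U * diagonal (fun i => aeval (β ^ (enum L i : ℕ)) p *
        (tauExt β L).eval (β ^ (enum L i : ℕ))) * (negCoprimeCols U)ᵀ) := by
  have ht : ∀ x : K, aeval x (tau (ZMod q) hL hβ) = (tauExt β L).eval x := by
    intro x
    rw [← map_tau (ZMod q) hL hβ, eval_map_algebraMap]
  rw [map_mul_aeval_cyc_mul hL hβ hG (map_transpose_eq hβ hG), mul_diagonal_mul_eq_of_zero_outside]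
  · simp only [map_mul, ht]
    rfl
  · intro j hj r r'
    rw [map_mul, ht, eval_tauExt_eq_zero hj, mul_zero, mul_zero, zero_mul]

/-- The matrix `T` as a matrix over `𝔽_q`. -/
noncomputable def transfer (hL : 1 < L) (hβ : IsPrimitiveRoot β L) (G : Matrix (Fin (J L)) (Fin L) (ZMod q)) :
    Matrix (Fin (J L)) (Fin (J L)) (ZMod q) :=
  (G * aeval (cyc (ZMod q) L) (tau (ZMod q) hL hβ) * Gᵀ)ᵀ

theorem TExt_transpose : (TExt β U)ᵀ = (L : K) • (coprimeCols U *
    diagonal (fun i => (tauExt β L).eval (β ^ (enum L i : ℕ))) * (negCoprimeCols U)ᵀ) := by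
  simp [TExt, transpose_mul, Matrix.mul_assoc]

theorem map_transfer (hL : 1 < L) (hβ : IsPrimitiveRoot β L)
    (hG : G.map (algebraMap (ZMod q) K) = U * vandInv β L) :
    (transfer hL hβ G).map (algebraMap (ZMod q) K) = TExt β U := by
  rw [transfer, transpose_map, ← transpose_transpose (TExt β U), TExt_transpose]
  have := map_mul_aeval_mul_tau hL hβ hG 1
  simp only [one_mul, map_one] at this
  rw [this]

/-- Negation permutes the residues coprime to `L`, so this is a column permutation of `coprimeCols
U`. -/
theorem isUnit_negCoprimeCols (h : IsUnit (coprimeCols U)) : IsUnit (negCoprimeCols U) := by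
  choose σ hσ using fun i : Fin (J L) => exists_enum_eq (negIdx_mem (enum_mem i))
  have hinj : Function.Injective σ := by
    intro a b hab
    apply enum_injective
    rw [← negIdx_negIdx (enum L a), ← hσ a, hab, hσ b, negIdx_negIdx]
  have : negCoprimeCols U = (coprimeCols U).submatrix id σ := by
    ext r i
    simp [negCoprimeCols, coprimeCols, hσ]
  rw [this]
  rw [← linearIndependent_cols_iff_isUnit] at h ⊢
  exact h.comp σ hinj

theorem isUnit_TExt (hL : 1 < L) (hβ : IsPrimitiveRoot β L) (h : IsUnit (coprimeCols U)) :
    IsUnit (TExt β U) := by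
  rw [TExt, isUnit_iff_isUnit_det, det_smul, det_mul, det_mul, det_diagonal, det_transpose,
    isUnit_iff_ne_zero]
  rw [isUnit_iff_isUnit_det, isUnit_iff_ne_zero] at h
  have h' := isUnit_negCoprimeCols ((isUnit_iff_isUnit_det _).2 (isUnit_iff_ne_zero.2 h))
  rw [isUnit_iff_isUnit_det, isUnit_iff_ne_zero] at h'
  exact mul_ne_zero (pow_ne_zero _ (natCast_ne_zero hL hβ)) (mul_ne_zero (mul_ne_zero h'
    (Finset.prod_ne_zero_iff.2 fun i _ => eval_tauExt_ne_zero hβ (enum_mem i))) h)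

theorem isUnit_transfer (hL : 1 < L) (hβ : IsPrimitiveRoot β L) (h : IsUnit (coprimeCols U))
    (hG : G.map (algebraMap (ZMod q) K) = U * vandInv β L) : IsUnit (transfer hL hβ G) := by
  have h1 := isUnit_TExt hL hβ h
  rw [← map_transfer hL hβ hG, isUnit_iff_isUnit_det, isUnit_iff_ne_zero,
    ← RingHom.mapMatrix_apply, ← RingHom.map_det] at h1
  rw [isUnit_iff_isUnit_det, isUnit_iff_ne_zero]
  exact fun h0 => h1 (by rw [h0, map_zero])

theorem mul_pow_mul_tau (hL : 1 < L) (hβ : IsPrimitiveRoot β L) (hU : Admissible U U')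
    (hG : G.map (algebraMap (ZMod q) K) = U * vandInv β L)
    (hH : H.map (algebraMap (ZMod q) K) = vand β L * U'ᵀ) (a : ℕ) :
    G * cyc (ZMod q) L ^ a * (aeval (cyc (ZMod q) L) (tau (ZMod q) hL hβ) * Gᵀ) =
      G * cyc (ZMod q) L ^ a * H * (transfer hL hβ G)ᵀ := by
  apply Matrix.map_injective (algebraMap (ZMod q) K).injective
  beta_reduce
  have h1 := map_mul_aeval_mul_tau hL hβ hG (X ^ a)
  have h2 := map_mul_aeval_mul_of_admissible hL hβ hU hG hH (X ^ a)
  simp only [map_mul, map_pow, aeval_X] at h1 h2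
  have h3 : G * cyc (ZMod q) L ^ a * (aeval (cyc (ZMod q) L) (tau (ZMod q) hL hβ) * Gᵀ) =
      G * (cyc (ZMod q) L ^ a * aeval (cyc (ZMod q) L) (tau (ZMod q) hL hβ)) * Gᵀ := by
    simp only [Matrix.mul_assoc]
  have hA := (isUnit_iff_isUnit_det _).1 hU.isUnit
  rw [h3, h1, Matrix.map_mul, h2, transpose_map, map_transfer hL hβ hG, TExt_transpose,
    Matrix.mul_smul]
  congr 1
  -- The $A^{-1}$ ending $G\,C^aH$ cancels the $A$ opening $T^{\mathrm T}$, and the two diagonals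
  -- merge.
  rw [← Matrix.mul_assoc, ← Matrix.mul_assoc, Matrix.mul_assoc _ (coprimeCols U)⁻¹,
    nonsing_inv_mul _ hA, Matrix.mul_one, Matrix.mul_assoc (coprimeCols U) (diagonal _) (diagonal _),
    diagonal_mul_diagonal]

/-- The coordinates of a codeword with respect to the columns of `U` indexed by `coprimeIdx L`. -/
theorem sum_codeword_mul {k n : ℕ} (hL : 1 < L) (hβ : IsPrimitiveRoot β L) (hU : Admissible U U')
    (hG : G.map (algebraMap (ZMod q) K) = U * vandInv β L)
    (hH : H.map (algebraMap (ZMod q) K) = vand β L * U'ᵀ) (l : Fin n → Fin L)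
    (m : Fin k × Fin (J L) → ZMod q) (i : Fin n) (j : Fin (J L)) :
    ∑ r, algebraMap (ZMod q) K (codeword l G H m r i) * U r (enum L j) =
      ∑ s : Fin k, (∑ r, algebraMap (ZMod q) K (m (s, r)) * U r (enum L j)) *
        (β ^ (enum L j : ℕ)) ^ (q ^ (s : ℕ) * (l i : ℕ)) := by
  have hA := (isUnit_iff_isUnit_det _).1 hU.isUnit
  simp only [codeword, of_apply, map_sum, Finset.sum_mul]
  rw [Finset.sum_comm]
  refine Finset.sum_congr rfl fun s _ => ?_
  rw [← Finset.sum_mul]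
  have h2 := map_mul_aeval_mul_of_admissible hL hβ hU hG hH (X ^ (q ^ (s : ℕ) * (l i : ℕ)))
  simp only [map_pow, aeval_X] at h2
  simp only [RingHom.map_vecMul]
  rw [h2]
  set v : Fin (J L) → K := algebraMap (ZMod q) K ∘ fun r' => m (s, r')
  set D : Matrix (Fin (J L)) (Fin (J L)) K :=
    diagonal fun i_1 => (β ^ (enum L i_1 : ℕ)) ^ (q ^ (s : ℕ) * (l i : ℕ))
  change ((v ᵥ* (coprimeCols U * D * (coprimeCols U)⁻¹)) ᵥ* coprimeCols U) j =
    (v ᵥ* coprimeCols U) j * _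
  rw [vecMul_vecMul, Matrix.mul_assoc, nonsing_inv_mul _ hA, Matrix.mul_one, ← vecMul_vecMul,
    vecMul_diagonal]

theorem eq_zero_of_sum_mul_eq_zero (hA : IsUnit (coprimeCols U)) {v : Fin (J L) → ZMod q}
    (h : ∀ j, ∑ r, algebraMap (ZMod q) K (v r) * U r (enum L j) = 0) : v = 0 := by
  have hzero : algebraMap (ZMod q) K ∘ v = 0 := by
    apply vecMul_injective_of_isUnit hA
    beta_reduce
    rw [zero_vecMul]
    exact funext h
  ext r
  exact (map_eq_zero _).1 (congrFun hzero r)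

end Admissible

/-! ### Linear codes over the extension field and their coordinates -/

theorem sub_mul_mem_gabLinear {q k n : ℕ} {E : Type*} [Field E]
    {pts x y : Fin n → E}
    (hx : x ∈ gabLinear q k pts) (hy : y ∈ gabLinear q k pts) (e : E) :
    (fun i => x i - e * y i) ∈ gabLinear q k pts := by
  obtain ⟨u, rfl⟩ := hx
  obtain ⟨w, rfl⟩ := hy
  refine ⟨u - e • w, ?_⟩
  simp only [sub_vecMul, smul_vecMul]
  rfl

section Coordinates

variable {q : ℕ} [Fact q.Prime] {E : Type*} [Field E] [Algebra (ZMod q) E]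

theorem eq_coordMatrix_iff {N n : ℕ} (b : Module.Basis (Fin N) (ZMod q) E) (v : Fin n → E)
    (M : Matrix (Fin N) (Fin n) (ZMod q)) :
    M = coordMatrix b v ↔ ∀ i, ∑ r, M r i • b r = v i := by
  constructor
  · rintro rfl i
    exact b.sum_repr (v i)
  · intro h
    ext r i
    rw [coordMatrix, of_apply, ← h i, b.repr_sum_self]

/-- The basis obtained from `b` by a change of basis with the inverse of an invertible matrix. -/
theorem exists_basis_vecMul_inv {N : ℕ} (b : Module.Basis (Fin N) (ZMod q) E)
    {T : Matrix (Fin N) (Fin N) (ZMod q)} (hT : IsUnit T) :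
    ∃ b' : Module.Basis (Fin N) (ZMod q) E,
      (∀ r, b' r = ((fun r => b r) ᵥ* (T.map (algebraMap (ZMod q) E))⁻¹) r) ∧
      ∀ (n : ℕ) (v : Fin n → E), coordMatrix b' v = T * coordMatrix b v := by
  have hdet := (isUnit_iff_isUnit_det _).1 hT
  let e : (Fin N → ZMod q) ≃ₗ[ZMod q] (Fin N → ZMod q) :=
    { Matrix.toLin' T with
      invFun := fun x => T⁻¹ *ᵥ x
      left_inv := fun x => by simp [mulVec_mulVec, nonsing_inv_mul _ hdet]
      right_inv := fun x => by simp [mulVec_mulVec, mul_nonsing_inv _ hdet] }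
  -- Coordinates in `b'` are `T` times those in `b`, so the basis vectors themselves transform by
  -- the inverse of `T`.
  let b' := Module.Basis.ofEquivFun (b.equivFun.trans e)
  have hinv : (T.map (algebraMap (ZMod q) E))⁻¹ = T⁻¹.map (algebraMap (ZMod q) E) := by
    apply inv_eq_right_inv
    rw [← Matrix.map_mul, mul_nonsing_inv _ hdet]
    simp
  refine ⟨b', fun r => ?_, fun n v => ?_⟩
  · rw [hinv]
    have h1 : b' r = b.equivFun.symm (T⁻¹ *ᵥ Pi.single r 1) := by
      simp only [b', Module.Basis.coe_ofEquivFun]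
      rfl
    rw [h1, Module.Basis.equivFun_symm_apply]
    simp only [mulVec_single_one, vecMul, dotProduct, map_apply, Algebra.smul_def]
    exact Finset.sum_congr rfl fun _ _ => mul_comm _ _
  · ext r i
    rfl

theorem coordCode_eq_image_mul {N n : ℕ} {b b' : Module.Basis (Fin N) (ZMod q) E}
    {T : Matrix (Fin N) (Fin N) (ZMod q)}
    (h : ∀ v : Fin n → E, coordMatrix b' v = T * coordMatrix b v) (V : Set (Fin n → E)) :
    coordCode b' V = (fun M => T * M) '' coordCode b V := by
  simp only [coordCode, Set.image_image, h]

end Coordinates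

/-! ### The case `J = m_L` -/

section FullOrder

variable {q : ℕ} [Fact q.Prime] {L : ℕ} {K : Type*} [Field K] [Algebra (ZMod q) K] {β : K}
  {U U' : Matrix (Fin (J L)) (Fin L) K} {G : Matrix (Fin (J L)) (Fin L) (ZMod q)}
  {H : Matrix (Fin L) (Fin (J L)) (ZMod q)}

/-- Frobenius fixes the coefficients of `f`, hence permutes its roots. -/
theorem aeval_pow_pow_eq_zero (f : (ZMod q)[X]) {x : K} (hx : aeval x f = 0) (t : ℕ) :
    aeval (x ^ q ^ t) f = 0 := by
  induction t with
  | zero => simpa using hx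
  | succ t ih =>
    have := aeval_algHom_apply (FiniteField.frobeniusAlgHom (ZMod q) K) (x ^ q ^ t) f
    rw [ih, map_zero, FiniteField.frobeniusAlgHom_apply, ZMod.card, ← pow_mul, ← pow_succ] at this
    exact this

theorem linearIndependent_col_one (hL : 1 < L) (hqL : Nat.Coprime q L) (hβ : IsPrimitiveRoot β L)
    (hJ : J L = mOrd q L) (hA : IsUnit (coprimeCols U))
    (hG : G.map (algebraMap (ZMod q) K) = U * vandInv β L) :
    LinearIndependent (ZMod q) fun r => U r ⟨1, hL⟩ := by
  have hL0 := natCast_ne_zero hL hβ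
  have hU : (L : K) • U = G.map (algebraMap (ZMod q) K) * vand β L := by
    rw [hG, Matrix.mul_assoc, vandInv_mul_vand hL hβ]
    simp
  rw [Fintype.linearIndependent_iff]
  intro a ha
  -- The coefficients of `f` form the row vector $a^{\mathrm T}G$, so $f(\beta^j)=L\,a^{\mathrm
  -- T}u_j$. A relation among the entries of $u_1$ says $f(\beta)=0$, which Frobenius spreads to all
  -- primitive `L`-th roots.
  let f : (ZMod q)[X] := ∑ i : Fin L, C (∑ r, a r * G r i) * X ^ (i : ℕ)
  have hf : ∀ j : Fin L, aeval (β ^ (j : ℕ)) f = L * ∑ r, a r • U r j := by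
    intro j
    have h1 : ∀ r, (L : K) * U r j =
        ∑ i, algebraMap (ZMod q) K (G r i) * β ^ ((i : ℕ) * (j : ℕ)) := fun r => by
      have := congrFun (congrFun hU r) j
      rwa [Matrix.mul_apply] at this
    simp only [f, map_sum, map_mul, aeval_C, map_pow, aeval_X, Algebra.smul_def, Finset.mul_sum,
      mul_left_comm (L : K), h1, Finset.sum_mul]
    rw [Finset.sum_comm]
    refine Finset.sum_congr rfl fun r _ => Finset.sum_congr rfl fun i _ => ?_
    rw [← pow_mul, mul_comm (j : ℕ), mul_assoc]
  have hf1 : aeval β f = 0 := by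
    have := hf ⟨1, hL⟩
    rwa [ha, mul_zero, pow_one] at this
  have hcols : ∀ j, ∑ r, algebraMap (ZMod q) K (a r) * U r (enum L j) = 0 := by
    intro j
    obtain ⟨t, ht⟩ := exists_pow_modEq hL hqL hJ (enum_coprime j)
    have := hf (enum L j)
    rw [← pow_eq_pow_of_modEq hβ ht, aeval_pow_pow_eq_zero f hf1] at this
    have h2 := (mul_eq_zero.1 this.symm).resolve_left hL0
    simpa only [Algebra.smul_def] using h2
  exact congrFun (eq_zero_of_sum_mul_eq_zero hA hcols)

theorem circCode_eq_coordCode {k n : ℕ} (hL : 1 < L) (hβ : IsPrimitiveRoot β L)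
    (hU : Admissible U U') (hG : G.map (algebraMap (ZMod q) K) = U * vandInv β L)
    (hH : H.map (algebraMap (ZMod q) K) = vand β L * U'ᵀ) (l : Fin n → Fin L)
    (B : Module.Basis (Fin (J L)) (ZMod q) K) (hB : ∀ r, B r = U r ⟨1, hL⟩) :
    circCode q k l G H = coordCode B (gabLinear q k fun i => β ^ (l i : ℕ)) := by
  have key : ∀ m : Fin k × Fin (J L) → ZMod q, codeword l G H m = coordMatrix B
      ((fun s => ∑ r, m (s, r) • B r) ᵥ* gabGen q k fun i => β ^ (l i : ℕ)) := by
    intro m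
    rw [eq_coordMatrix_iff]
    intro i
    obtain ⟨j, hj⟩ := exists_enum_eq_one hL
    have := sum_codeword_mul hL hβ hU hG hH l m i j
    rw [hj] at this
    simp only [hB, Algebra.smul_def]
    rw [this]
    simp only [vecMul, dotProduct, gabGen, of_apply, pow_one]
    refine Finset.sum_congr rfl fun s _ => ?_
    rw [← pow_mul, mul_comm (l i : ℕ)]
  rw [circCode_eq_range]
  apply Set.Subset.antisymm
  · rintro _ ⟨m, rfl⟩
    exact ⟨_, ⟨_, rfl⟩, (key m).symm⟩
  · rintro _ ⟨_, ⟨u, rfl⟩, rfl⟩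
    -- Since `B` is a basis, every coefficient vector over `K` comes from a message.
    refine ⟨fun x => B.repr (u x.1) x.2, ?_⟩
    rw [key]
    simp only [B.sum_repr]

theorem linearIndependent_points {n : ℕ} (hL : 1 < L) (hβ : IsPrimitiveRoot β L)
    (hU : Admissible U U') (hG : G.map (algebraMap (ZMod q) K) = U * vandInv β L)
    (hH : H.map (algebraMap (ZMod q) K) = vand β L * U'ᵀ) (l : Fin n → Fin L)
    (h : ∀ a : Fin n → ZMod q, a ≠ 0 →
      (∑ i, a i • (G * cyc (ZMod q) L ^ (l i : ℕ) * H)).rank = J L) :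
    LinearIndependent (ZMod q) fun i => β ^ (l i : ℕ) := by
  rw [Fintype.linearIndependent_iff]
  intro a ha
  by_contra hne
  have ha0 : a ≠ 0 := fun h0 => hne fun i => by rw [h0]; rfl
  have hunit := isUnit_of_rank_eq_card (h a ha0)
  let p : (ZMod q)[X] := ∑ i, a i • X ^ (l i : ℕ)
  have hp : ∑ i, a i • (G * cyc (ZMod q) L ^ (l i : ℕ) * H) =
      G * aeval (cyc (ZMod q) L) p * H := by
    simp only [p, map_sum, map_smul, map_pow, aeval_X, Matrix.mul_sum, Matrix.sum_mul,
      Matrix.mul_smul, Matrix.smul_mul]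
  obtain ⟨j, hj⟩ := exists_enum_eq_one hL
  rw [hp, isUnit_iff_isUnit_det, isUnit_iff_ne_zero] at hunit
  -- A relation $p(\beta)=0$ puts a zero on the diagonal at the index of 1, making the full-rank
  -- matrix singular.
  apply hunit
  apply (algebraMap (ZMod q) K).injective
  rw [RingHom.map_det, RingHom.mapMatrix_apply, map_mul_aeval_mul_of_admissible hL hβ hU hG hH,
    det_mul, det_mul, det_diagonal, Finset.prod_eq_zero (Finset.mem_univ j), mul_zero, zero_mul,
    map_zero]
  simpa [hj, p] using ha

end FullOrder

/-! ### The case `J ≠ m_L` -/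

/-- The power sums satisfy the linear recurrence with characteristic polynomial
$\prod_s(X-\omega_s)$. When the intermediate sums vanish, only its constant and leading coefficients
contribute. -/
theorem sum_mul_pow_eq_of_eq_zero {K : Type*} [Field K] {k : ℕ} (hk : 0 < k) (z ω : Fin k → K)
    (h : ∀ t, 0 < t → t < k → ∑ s, z s * ω s ^ t = 0) :
    ∑ s, z s * ω s ^ k = (-1) ^ (k + 1) * (∏ s, ω s) * ∑ s, z s := by
  let P : K[X] := ∏ s, (X - C (ω s))
  have hdeg : P.natDegree = k := by simp [P, natDegree_finsetProd_X_sub_C_eq_card]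
  have hmonic : P.Monic := monic_prod_X_sub_C _ _
  have h0 : P.coeff 0 = (-1) ^ k * ∏ s, ω s := by
    rw [coeff_zero_eq_eval_zero, eval_prod]
    simp [Finset.prod_neg]
  have hsum : ∑ t ∈ Finset.range (k + 1), P.coeff t * ∑ s, z s * ω s ^ t = 0 := by
    simp only [Finset.mul_sum]
    rw [Finset.sum_comm]
    refine Finset.sum_eq_zero fun s _ => ?_
    have : P.eval (ω s) = 0 := by
      rw [eval_prod]
      exact Finset.prod_eq_zero (Finset.mem_univ s) (by simp)
    rw [eval_eq_sum_range, hdeg] at this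
    simp only [mul_left_comm _ (z s)]
    rw [← Finset.mul_sum, this, mul_zero]
  obtain ⟨k, rfl⟩ : ∃ k', k = k' + 1 := ⟨k - 1, by omega⟩
  rw [Finset.sum_range_succ, Finset.sum_range_succ', Finset.sum_eq_zero, zero_add, h0] at hsum
  · have hlead : P.coeff (k + 1) = 1 := by
      rw [← hdeg]; exact hmonic
    rw [hlead, one_mul] at hsum
    simp only [pow_zero, mul_one] at hsum
    rw [eq_neg_of_add_eq_zero_right hsum]
    ring
  · intro t ht
    rw [h _ (Nat.succ_pos t) (by have := Finset.mem_range.1 ht; omega), mul_zero]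

theorem pow_mul_pow_injective {q L k : ℕ} {K : Type*} [Field K] {β : K}
    (hL : 1 < L) (hβ : IsPrimitiveRoot β L) (hk : k ≤ mOrd q L)
    {a : ℕ} (ha : Nat.Coprime a L) :
    Function.Injective fun s : Fin k => β ^ (a * q ^ (s : ℕ)) := by
  intro s t hst
  have hprim := hβ.pow_of_coprime a ha
  simp only [pow_mul] at hst
  have h2 : q ^ (s : ℕ) ≡ q ^ (t : ℕ) [MOD L] := by
    have hL0 : 0 < L := by omega
    refine hprim.pow_inj (Nat.mod_lt _ hL0) (Nat.mod_lt _ hL0) ?_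
    rw [hprim.eq_orderOf, pow_mod_orderOf, pow_mod_orderOf, hst]
  rw [← ZMod.natCast_eq_natCast_iff] at h2
  push_cast at h2
  exact Fin.ext (pow_injOn_Iio_orderOf (show (s : ℕ) < _ from s.2.trans_le hk)
    (show (t : ℕ) < _ from t.2.trans_le hk) h2)

section NotFullOrder

variable {q : ℕ} [Fact q.Prime] {L k n : ℕ} {K : Type*} [Field K] [Algebra (ZMod q) K] {β : K}
  {U U' : Matrix (Fin (J L)) (Fin L) K} {G : Matrix (Fin (J L)) (Fin L) (ZMod q)}
  {H : Matrix (Fin L) (Fin (J L)) (ZMod q)} {l : Fin n → Fin L} {c c' : ℕ}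

/-- For affine exponents the dependence on the column `i` is purely geometric; the offset `c` is
absorbed into the weights. -/
theorem sum_codeword_mul_of_affine (hL : 1 < L) (hβ : IsPrimitiveRoot β L) (hU : Admissible U U')
    (hG : G.map (algebraMap (ZMod q) K) = U * vandInv β L)
    (hH : H.map (algebraMap (ZMod q) K) = vand β L * U'ᵀ)
    (hl : ∀ i : Fin n, (l i : ℕ) = (c' * (i : ℕ) + c) % L)
    (m : Fin k × Fin (J L) → ZMod q) (j : Fin (J L)) (i : Fin n) :
    ∑ r, algebraMap (ZMod q) K (codeword l G H m r i) * U r (enum L j) =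
      ∑ s : Fin k, ((∑ r, algebraMap (ZMod q) K (m (s, r)) * U r (enum L j)) *
        β ^ ((enum L j : ℕ) * (q ^ (s : ℕ) * c))) *
        (β ^ ((enum L j : ℕ) * (c' * q ^ (s : ℕ)))) ^ (i : ℕ) := by
  rw [sum_codeword_mul hL hβ hU hG hH]
  refine Finset.sum_congr rfl fun s _ => ?_
  rw [mul_assoc]
  congr 1
  rw [← pow_mul, ← pow_mul, ← pow_add]
  apply pow_eq_pow_of_modEq hβ
  have h1 : (l i : ℕ) ≡ c' * (i : ℕ) + c [MOD L] := by
    rw [hl]; exact Nat.mod_modEq _ _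
  have h2 := (h1.mul_left (q ^ (s : ℕ))).mul_left (enum L j : ℕ)
  refine h2.trans ?_
  have h3 : (enum L j : ℕ) * (q ^ (s : ℕ) * (c' * (i : ℕ) + c)) =
    (enum L j : ℕ) * (q ^ (s : ℕ) * c) + (enum L j : ℕ) * (c' * q ^ (s : ℕ)) * (i : ℕ) := by ring
  rw [h3]

theorem exists_codeword_first_columns (hL : 1 < L) (hβ : IsPrimitiveRoot β L)
    (hU : Admissible U U') (hG : G.map (algebraMap (ZMod q) K) = U * vandInv β L)
    (hH : H.map (algebraMap (ZMod q) K) = vand β L * U'ᵀ) (hkn : k ≤ n) (hk : k ≤ mOrd q L)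
    (hc' : Nat.Coprime c' L) (hl : ∀ i : Fin n, (l i : ℕ) = (c' * (i : ℕ) + c) % L)
    (w : Fin k × Fin (J L) → ZMod q) :
    ∃ m : Fin k × Fin (J L) → ZMod q,
      ∀ (t : Fin k) (r : Fin (J L)), codeword l G H m r (Fin.castLE hkn t) = w (t, r) := by
  let f : (Fin k × Fin (J L) → ZMod q) →ₗ[ZMod q] (Fin k × Fin (J L) → ZMod q) :=
    { toFun := fun m x => codeword l G H m x.2 (Fin.castLE hkn x.1)
      map_add' := fun m m' => by ext x; rw [codeword_add]; rfl
      map_smul' := fun a m => by ext x; rw [codeword_smul]; rfl }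
  have hinj : Function.Injective f := by
    rw [← LinearMap.ker_eq_bot, LinearMap.ker_eq_bot']
    intro m hm
    have hm' : ∀ (t : Fin k) r, codeword l G H m r (Fin.castLE hkn t) = 0 :=
      fun t r => congrFun hm (t, r)
    have hs : ∀ s : Fin k, (fun r => m (s, r)) = 0 := by
      intro s
      apply eq_zero_of_sum_mul_eq_zero hU.isUnit
      intro j
      -- For fixed `j` the first `k` columns give a Vandermonde system; its nodes are distinct
      -- because `k` does not exceed the order of `q`.
      have hz := eq_zero_of_forall_pow_sum_mul_pow_eq_zero
        (pow_mul_pow_injective (q := q) hL hβ hk (Nat.Coprime.mul_left (enum_coprime j) hc'))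
        (v := fun s : Fin k => (∑ r, algebraMap (ZMod q) K (m (s, r)) * U r (enum L j)) *
          β ^ ((enum L j : ℕ) * (q ^ (s : ℕ) * c))) ?_
      · have hne : β ^ ((enum L j : ℕ) * (q ^ (s : ℕ) * c)) ≠ 0 :=
          pow_ne_zero _ (hβ.ne_zero (by omega))
        exact (mul_eq_zero.1 (congrFun hz s)).resolve_right hne
      · intro t
        have := sum_codeword_mul_of_affine hL hβ hU hG hH hl m j (Fin.castLE hkn t)
        simp only [hm', map_zero, zero_mul, Finset.sum_const_zero] at this
        simpa only [mul_assoc, Fin.val_castLE] using this.symm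
    ext ⟨s, r⟩
    exact congrFun (hs s) r
  -- Messages and prescribed first `k` columns have equal dimension, so injectivity suffices.
  obtain ⟨m, hm⟩ := LinearMap.injective_iff_surjective.1 hinj w
  exact ⟨m, fun t r => congrFun hm (t, r)⟩

theorem sum_codeword_mul_eq_of_eq_zero (hL : 1 < L) (hβ : IsPrimitiveRoot β L)
    (hU : Admissible U U') (hG : G.map (algebraMap (ZMod q) K) = U * vandInv β L)
    (hH : H.map (algebraMap (ZMod q) K) = vand β L * U'ᵀ) (hk : 0 < k) (hkn : k < n)
    (hl : ∀ i : Fin n, (l i : ℕ) = (c' * (i : ℕ) + c) % L) (m : Fin k × Fin (J L) → ZMod q)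
    (hm : ∀ t : Fin n, 0 < (t : ℕ) → (t : ℕ) < k → ∀ r, codeword l G H m r t = 0)
    (j : Fin (J L)) :
    ∑ r, algebraMap (ZMod q) K (codeword l G H m r ⟨k, hkn⟩) * U r (enum L j) =
      (-1) ^ (k + 1) * (β ^ (∑ s ∈ Finset.range k, c' * q ^ s)) ^ (enum L j : ℕ) *
        ∑ r, algebraMap (ZMod q) K (codeword l G H m r ⟨0, hk.trans hkn⟩) * U r (enum L j) := by
  have hrec := sum_codeword_mul_of_affine hL hβ hU hG hH hl m j
  rw [hrec, hrec, sum_mul_pow_eq_of_eq_zero hk]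
  · congr 1
    · congr 1
      rw [Finset.prod_pow_eq_pow_sum, ← Finset.mul_sum,
        Fin.sum_univ_eq_sum_range (fun s => c' * q ^ s), mul_comm, pow_mul]
    · simp
  · intro t ht htk
    rw [← hrec ⟨t, htk.trans hkn⟩]
    simp [hm ⟨t, htk.trans hkn⟩ ht htk]

/-- For no field structure on the column space are the codewords a linear code. -/
theorem not_linear_over_extension (hL : 1 < L) (hqL : Nat.Coprime q L) (hβ : IsPrimitiveRoot β L)
    (hU : Admissible U U') (hG : G.map (algebraMap (ZMod q) K) = U * vandInv β L)
    (hH : H.map (algebraMap (ZMod q) K) = vand β L * U'ᵀ) (hkn : k < n) (hn : n ≤ mOrd q L)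
    (hK : Module.finrank (ZMod q) K = mOrd q L) (hJ : J L ≠ mOrd q L)
    (hcop : Nat.Coprime (∑ s ∈ Finset.range k, c' * q ^ s) L)
    (hl : ∀ i : Fin n, (l i : ℕ) = (c' * (i : ℕ) + c) % L)
    {E : Type*} [Field E] [Algebra (ZMod q) E] [FiniteDimensional (ZMod q) E]
    (φ : (Fin (J L) → ZMod q) ≃ₗ[ZMod q] E) (V : Set (Fin n → E))
    (hV : ∀ x ∈ V, ∀ y ∈ V, ∀ e : E, (fun i => x i - e * y i) ∈ V)
    (h : ∀ M : Matrix (Fin (J L)) (Fin n) (ZMod q),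
      M ∈ circCode q k l G H ↔ (fun i => φ fun r => M r i) ∈ V) : False := by
  -- For `k = 0` the empty sum is 0, which is not coprime to `L > 1`.
  have hk : 0 < k := by
    rcases Nat.eq_zero_or_pos k with rfl | hk
    · simp at hcop; omega
    · exact hk
  have hc' : Nat.Coprime c' L := by
    rw [← Finset.mul_sum] at hcop
    exact hcop.coprime_mul_right
  have : FiniteDimensional (ZMod q) K :=
    Module.finite_of_finrank_pos (hK ▸ mOrd_pos hL hqL)
  have hJm : mOrd q L < J L := lt_of_le_of_ne (mOrd_le_J hL hqL) hJ.symm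
  simp only [circCode_eq_range, Set.mem_range] at h
  set lam : Fin (J L) → K := fun j =>
    (-1) ^ (k + 1) * (β ^ (∑ s ∈ Finset.range k, c' * q ^ s)) ^ (enum L j : ℕ) with hlam
  -- Coprimality of $\sum_s c'q^s$ to `L` keeps the base a primitive `L`-th root of unity.
  have hlam_inj : Function.Injective lam := by
    intro i j hij
    have hne : ((-1 : K)) ^ (k + 1) ≠ 0 := pow_ne_zero _ (by simp)
    exact enum_injective (Fin.ext ((hβ.pow_of_coprime _ hcop).pow_inj (enum L i).2 (enum L j).2
      (mul_left_cancel₀ hne hij)))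
  let i0 : Fin n := ⟨0, hk.trans hkn⟩
  let ik : Fin n := ⟨k, hkn⟩
  have hext : ∀ v : Fin (J L) → ZMod q, ∃ m : Fin k × Fin (J L) → ZMod q,
      (∀ r, codeword l G H m r i0 = v r) ∧
      ∀ t : Fin n, 0 < (t : ℕ) → (t : ℕ) < k → ∀ r, codeword l G H m r t = 0 := by
    intro v
    obtain ⟨m, hm⟩ := exists_codeword_first_columns hL hβ hU hG hH hkn.le (hkn.le.trans hn) hc' hl
      fun x => if (x.1 : ℕ) = 0 then v x.2 else 0
    refine ⟨m, fun r => ?_, fun t ht htk r => ?_⟩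
    · have := hm ⟨0, hk⟩ r
      simpa using this
    · have := hm ⟨t, htk⟩ r
      simpa [ht.ne'] using this
  have hrec := fun m hm j => sum_codeword_mul_eq_of_eq_zero hL hβ hU hG hH hk hkn hl m hm j
  -- `ψ j` is the pairing with $u_j$ transported to `E`; it will be an eigenfunctional of
  -- multiplication by `y`.
  let ψ : Fin (J L) → E →ₗ[ZMod q] K := fun j =>
    { toFun := fun e => ∑ r, algebraMap (ZMod q) K (φ.symm e r) * U r (enum L j)
      map_add' := fun x y => by simp [add_mul, Finset.sum_add_distrib]
      map_smul' := fun a x => by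
        simp only [map_smul, Pi.smul_apply, smul_eq_mul, map_mul, RingHom.id_apply]
        rw [Algebra.smul_def, Finset.mul_sum]
        simp only [mul_assoc] }
  choose m hm0 hmt using hext
  have hmk : ∀ v j, ψ j (φ fun r => codeword l G H (m v) r ik) = lam j * ψ j (φ v) := by
    intro v j
    have := hrec (m v) (hmt v) j
    simp only [ψ, LinearMap.coe_mk, AddHom.coe_mk, LinearEquiv.symm_apply_apply]
    rw [this]
    congr 1
    exact Finset.sum_congr rfl fun r _ => by rw [hm0 v r]
  have hcol0 : ∀ v, (φ fun r => codeword l G H (m v) r i0) = φ v := fun v =>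
    congrArg φ (funext (hm0 v))
  have hcolt : ∀ v (t : Fin n), 0 < (t : ℕ) → (t : ℕ) < k →
      (φ fun r => codeword l G H (m v) r t) = 0 := fun v t ht htk => by
    rw [show (fun r => codeword l G H (m v) r t) = 0 from funext (hmt v t ht htk), map_zero]
  set y : E := φ fun r => codeword l G H (m (φ.symm 1)) r ik with hy
  -- Subtract `e` times the codeword starting with 1 from the one starting with `e`. Linearity keeps
  -- the difference in the code, its columns `0, …, k - 1` vanish, and so column `k` vanishes as
  -- well.
  have hmul : ∀ e : E, (φ fun r => codeword l G H (m (φ.symm e)) r ik) = e * y := by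
    intro e
    have hmem := hV _ ((h _).1 ⟨m (φ.symm e), rfl⟩) _ ((h _).1 ⟨m (φ.symm 1), rfl⟩) e
    obtain ⟨d, hd⟩ := (h (Matrix.of fun r i => φ.symm
      ((φ fun r => codeword l G H (m (φ.symm e)) r i) -
        e * φ fun r => codeword l G H (m (φ.symm 1)) r i) r)).2 (by
        simpa only [of_apply, LinearEquiv.apply_symm_apply] using hmem)
    have hd' : ∀ i, (fun r => codeword l G H d r i) = φ.symm
        ((φ fun r => codeword l G H (m (φ.symm e)) r i) -
          e * φ fun r => codeword l G H (m (φ.symm 1)) r i) := fun i => by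
      rw [hd]; rfl
    have hd0 : (fun r => codeword l G H d r i0) = 0 := by
      rw [hd', hcol0, hcol0]
      simp
    have hdt : ∀ t : Fin n, 0 < (t : ℕ) → (t : ℕ) < k → ∀ r, codeword l G H d r t = 0 := by
      intro t ht htk r
      refine congrFun (?_ : (fun r => codeword l G H d r t) = 0) r
      rw [hd', hcolt _ t ht htk, hcolt _ t ht htk]
      simp
    have hdk : (fun r => codeword l G H d r ik) = 0 := by
      apply eq_zero_of_sum_mul_eq_zero hU.isUnit
      intro j
      refine (hrec d hdt j).trans (mul_eq_zero_of_right _ (Finset.sum_eq_zero fun r _ => ?_))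
      rw [congrFun hd0 r, Pi.zero_apply, map_zero, zero_mul]
    rw [hd', LinearEquiv.map_eq_zero_iff, sub_eq_zero] at hdk
    exact hdk
  have hψ : ∀ j e, ψ j (e * y) = lam j * ψ j e := fun j e => by
    rw [← hmul, hmk, LinearEquiv.apply_symm_apply]
  have hψp : ∀ (p : (ZMod q)[X]) j e, ψ j (e * aeval y p) = aeval (lam j) p * ψ j e := by
    intro p j
    induction p using Polynomial.induction_on' with
    | add p r hp hr => intro e; simp only [map_add, mul_add, add_mul, hp, hr]
    | monomial s a =>
      have hpow : ∀ e, ψ j (e * y ^ s) = lam j ^ s * ψ j e := by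
        induction s with
        | zero => simp
        | succ s ih =>
          intro e
          rw [pow_succ, ← mul_assoc, hψ, ih, pow_succ']
          ring
      intro e
      simp only [aeval_monomial]
      rw [mul_left_comm, ← Algebra.smul_def, map_smul, hpow, Algebra.smul_def, mul_assoc]
  have hroot : ∀ j, aeval (lam j) (minpoly (ZMod q) y) = 0 := by
    intro j
    by_contra hne
    have hzero : ∀ e, ψ j e = 0 := fun e => by
      have := hψp (minpoly (ZMod q) y) j e
      rw [minpoly.aeval, mul_zero, map_zero] at this
      exact (mul_eq_zero.1 this.symm).resolve_left hne
    -- A vanishing `ψ j` would make column `j` of an invertible matrix zero.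
    refine (linearIndependent_cols_iff_isUnit.2 hU.isUnit).ne_zero j ?_
    ext r
    have := hzero (φ (Pi.single r 1))
    simpa [coprimeCols, ψ, Pi.single_apply, apply_ite (algebraMap (ZMod q) K)] using this
  have hint : IsIntegral (ZMod q) y := Algebra.IsIntegral.isIntegral y
  classical
  have hJle : J L ≤ (minpoly (ZMod q) y).natDegree := by
    have hne : (minpoly (ZMod q) y).map (algebraMap (ZMod q) K) ≠ 0 :=
      Polynomial.map_ne_zero (minpoly.ne_zero hint)
    have hsub : (Finset.univ.image lam).val ⊆
        ((minpoly (ZMod q) y).map (algebraMap (ZMod q) K)).roots := by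
      intro x hx
      obtain ⟨j, -, rfl⟩ := Finset.mem_image.1 (Finset.mem_def.2 hx)
      rw [mem_roots hne, IsRoot, eval_map_algebraMap]
      exact hroot j
    have := card_le_degree_of_subset_roots hsub
    rwa [Finset.card_image_of_injective _ hlam_inj, Finset.card_univ, Fintype.card_fin,
      natDegree_map] at this
  have hle : (minpoly (ZMod q) y).natDegree ≤ mOrd q L := by
    -- The minimal polynomial of `y` is also that of an element of `K`, so its degree is bounded by
    -- $[K:\mathbb F_q]=m_L$.
    rw [minpoly.eq_of_irreducible_of_monic (minpoly.irreducible hint) (hroot ⟨0, J_pos hL⟩)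
      (minpoly.monic hint), ← hK]
    exact minpoly.natDegree_le _
  omega

end NotFullOrder

end CircShift

/-! ### Assembly of the two cases -/

theorem theorem3
    (q : ℕ) [Fact q.Prime] (L k n : ℕ) (hL : 1 < L) (hqL : Nat.Coprime q L)
    (hkn : k < n) (hn : n ≤ CircShift.mOrd q L)
    -- `K` is the field with `q ^ m_L` elements
    (K : Type*) [Field K] [Algebra (ZMod q) K]
    (hK : Module.finrank (ZMod q) K = CircShift.mOrd q L)
    (β : K) (hβ : IsPrimitiveRoot β L)
    (U U' : Matrix (Fin (CircShift.J L)) (Fin L) K) (hU : CircShift.Admissible U U')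
    -- `G_L` and `H_L` are matrices over `𝔽_q`
    (G : Matrix (Fin (CircShift.J L)) (Fin L) (ZMod q))
    (H : Matrix (Fin L) (Fin (CircShift.J L)) (ZMod q))
    (hG : G.map (algebraMap (ZMod q) K) = U * CircShift.vandInv β L)
    (hH : H.map (algebraMap (ZMod q) K) = CircShift.vand β L * U'ᵀ)
    (l : Fin n → Fin L)
    (C₁ C₂ : Set (Matrix (Fin (CircShift.J L)) (Fin n) (ZMod q)))
    (hC₁ : C₁ = CircShift.circCode q k l G H)
    (hC₂ : C₂ = CircShift.circCode q k l G
      (aeval (CircShift.cyc (ZMod q) L) (CircShift.tau (ZMod q) hL hβ) * Gᵀ)) :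
    -- the case `J ≠ m_L`
    (CircShift.J L ≠ CircShift.mOrd q L →
      ∀ c c' : ℕ, c ≤ L - 1 → 1 ≤ c' → c' ≤ L - 1 →
        Nat.Coprime (∑ j ∈ Finset.range k, c' * q ^ j) L →
        (∀ j : Fin n, (l j : ℕ) = (c' * (j : ℕ) + c) % L) →
        ∀ (E : Type*) [Field E] [Algebra (ZMod q) E],
          Module.finrank (ZMod q) E = CircShift.J L →
            ¬ CircShift.IsGabidulin E k C₁ ∧ ¬ CircShift.IsGabidulin E k C₂) ∧
    -- the case `J = m_L`
    (CircShift.J L = CircShift.mOrd q L →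
      ((∀ a : Fin n → ZMod q, a ≠ 0 →
          (∑ i, a i • (G * CircShift.cyc (ZMod q) L ^ (l i : ℕ) * H)).rank = CircShift.J L) →
        LinearIndependent (ZMod q) fun i => β ^ (l i : ℕ)) ∧
      ∃ (B B' : Module.Basis (Fin (CircShift.J L)) (ZMod q) K)
        (T : Matrix (Fin (CircShift.J L)) (Fin (CircShift.J L)) (ZMod q)),
        (∀ r, B r = U r ⟨1, hL⟩) ∧
        T.map (algebraMap (ZMod q) K) = CircShift.TExt β U ∧
        IsUnit T ∧
        (∀ r, B' r = ((fun r => U r ⟨1, hL⟩) ᵥ* (CircShift.TExt β U)⁻¹) r) ∧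
        C₁ = CircShift.coordCode B (CircShift.gabLinear q k fun i => β ^ (l i : ℕ)) ∧
        C₂ = (fun M => T * M) ''
          CircShift.coordCode B (CircShift.gabLinear q k fun i => β ^ (l i : ℕ)) ∧
        C₂ = CircShift.coordCode B' (CircShift.gabLinear q k fun i => β ^ (l i : ℕ))) := by
  subst hC₁ hC₂
  have hT := CircShift.isUnit_transfer hL hβ hU.isUnit hG
  have hC₂ : CircShift.circCode q k l G
      (aeval (CircShift.cyc (ZMod q) L) (CircShift.tau (ZMod q) hL hβ) * Gᵀ) =
      (fun M => CircShift.transfer hL hβ G * M) '' CircShift.circCode q k l G H := by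
    rw [CircShift.circCode_eq_range, CircShift.circCode_eq_range, ← Set.range_comp]
    congr 1
    funext m
    exact CircShift.codeword_mul_transpose l G (CircShift.mul_pow_mul_tau hL hβ hU hG hH) m
  refine ⟨fun hJ c c' _ _ _ hcop hl E _ _ hE => ?_, fun hJ => ⟨fun h =>
    CircShift.linearIndependent_points hL hβ hU hG hH l h, ?_⟩⟩
  · have hE0 : FiniteDimensional (ZMod q) E :=
      Module.finite_of_finrank_pos (hE ▸ CircShift.J_pos hL)
    have key : ∀ (b : Module.Basis (Fin (CircShift.J L)) (ZMod q) E) (pts : Fin n → E),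
        CircShift.circCode q k l G H ≠ CircShift.coordCode b (CircShift.gabLinear q k pts) := by
      intro b pts h
      refine CircShift.not_linear_over_extension hL hqL hβ hU hG hH hkn hn hK hJ hcop hl
        b.equivFun.symm (CircShift.gabLinear q k pts)
        (fun x hx y hy e => CircShift.sub_mul_mem_gabLinear hx hy e) fun M => ?_
      rw [h]
      simp only [Module.Basis.equivFun_symm_apply]
      constructor
      · rintro ⟨v, hv, hM⟩
        rwa [funext ((CircShift.eq_coordMatrix_iff b v M).1 hM.symm)]
      · exact fun hM => ⟨_, hM, ((CircShift.eq_coordMatrix_iff b _ M).2 fun _ => rfl).symm⟩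
    refine ⟨fun ⟨b, pts, _, h⟩ => key b pts h, fun ⟨b, pts, _, h⟩ => ?_⟩
    -- Multiplying by the inverse of `T` turns a Gabidulin description of the second code into one
    -- of the first, with another basis and the same points.
    obtain ⟨S, hS⟩ := hT
    obtain ⟨b', -, hb'⟩ := CircShift.exists_basis_vecMul_inv b (S⁻¹).isUnit
    apply key b' pts
    rw [CircShift.coordCode_eq_image_mul (hb' n), ← h, hC₂, Set.image_image, ← hS]
    simp [← Matrix.mul_assoc]
  · have hcard : Fintype.card (Fin (CircShift.J L)) = Module.finrank (ZMod q) K := by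
      rw [Fintype.card_fin, hJ, hK]
    have : Nonempty (Fin (CircShift.J L)) := ⟨⟨0, CircShift.J_pos hL⟩⟩
    have hli := CircShift.linearIndependent_col_one hL hqL hβ hJ hU.isUnit hG
    let B := basisOfLinearIndependentOfCardEqFinrank hli hcard
    have hB : ∀ r, B r = U r ⟨1, hL⟩ := fun r => by
      simp [B, coe_basisOfLinearIndependentOfCardEqFinrank]
    obtain ⟨B', hB', hcoord⟩ := CircShift.exists_basis_vecMul_inv B hT
    have hmap := CircShift.map_transfer hL hβ hG
    have hC₁ := CircShift.circCode_eq_coordCode (k := k) hL hβ hU hG hH l B hB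
    refine ⟨B, B', CircShift.transfer hL hβ G, hB, hmap, hT, ?_, hC₁, ?_, ?_⟩
    · rw [hmap] at hB'
      simpa only [hB] using hB'
    · rw [hC₂, hC₁]
    · rw [CircShift.coordCode_eq_image_mul (hcoord n), hC₂, hC₁]
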